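/- Let $G$ be a finite simple graph with $n$ vertices and exactly $2n-2$ edges. Suppose that no subgraph $H\neq G$ of $G$ (induced or not) has minimum degree $3$. Then $G$ is pancyclic, that is, $G$ contains a cycle of length $i$ for every integer $i$ with $3\le i\le n$. -/

import Mathlib

open Classical in
/-- The subgraph `H`, regarded as a graph on its own vertex set, has minimum degree `d`.
(For `d ≠ 0` this excludes the subgraph without vertices, whose `minDegree` is `0`.) -/
def SubgraphHasMinDegree {V : Type*} [Fintype V] {G : SimpleGraph V}
    (H : G.Subgraph) (d : ℕ) : Prop :=
  H.coe.minDegree = d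

/-- A finite graph is pancyclic if it contains a cycle of every length from `3` up to its number
of vertices. -/
def IsPancyclic {V : Type*} [Fintype V] (G : SimpleGraph V) : Prop :=
  ∀ i : ℕ, 3 ≤ i → i ≤ Fintype.card V →
    ∃ (u : V) (p : G.Walk u u), p.IsCycle ∧ p.length = i

/-!
If `A` is a nonempty set of vertices with at least two vertices outside it, then `G - A` is
`2`-degenerate, so it has at most `2 * (n - #A) - 3` edges, and at least `2 * #A + 1` edges meet
`A`. Hence all degrees are at least `3`. By minimality under deleting edges the set `I` of vertices
of degree at least `4` is independent. If `2 ≤ #I`, the bound makes every component of the subgraph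
on the cubic vertices a tree, and counting edges shows that there are `2 * #I - 2` of them.

For each such component `C`, minimality provides `w ∈ I` with at most two neighbours outside `C`.
If `3 ≤ #I`, two components `C` and `D` share the same `w`, and then too few edges meet
`C ∪ D ∪ {w}`. If `#I ≤ 1`, all vertices but one vertex `w` are cubic, `w` is adjacent to all
others, and `G - w` is connected of maximum degree `2`; a Hamiltonian path of `G - w` and `w` give
cycles of all lengths. If `I = {x, y}`, there are two components. Each of them, say `D`, sends
`#D + 2` edges to `I`, of which one of `x` and `y` receives only two, so the other one is adjacent
to all of `D`, and `D` is a path starting at a common neighbour of `x` and `y`. This gives paths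
from `x` to `y` with any number from `1` to `#D` of internal vertices in `D`, and gluing one through
each component gives the cycles of length at least `4`.
-/

open Finset SimpleGraph

section Counting

variable {V : Type*} (G : SimpleGraph V) [DecidableRel G.Adj]

/-- The number of neighbours of `v` in `S`, whether or not `v` itself lies in `S`. -/
def degIn (S : Finset V) (v : V) : ℕ := #{w ∈ S | G.Adj v w}

lemma degIn_mono {S T : Finset V} (h : S ⊆ T) (v : V) : degIn G S v ≤ degIn G T v :=
  card_le_card (filter_subset_filter _ h)

lemma degIn_univ [Fintype V] (v : V) : degIn G univ v = G.degree v := by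
  rw [degIn, ← neighborFinset_eq_filter, card_neighborFinset_eq_degree]

lemma degIn_union [DecidableEq V] {S T : Finset V} (h : Disjoint S T) (v : V) :
    degIn G (S ∪ T) v = degIn G S v + degIn G T v := by
  rw [degIn, filter_union, card_union_of_disjoint (disjoint_filter_filter h), degIn, degIn]

lemma degIn_add_degIn_compl [Fintype V] [DecidableEq V] (S : Finset V) (v : V) :
    degIn G S v + degIn G Sᶜ v = G.degree v := by
  rw [← degIn_union G disjoint_compl_right, union_compl, degIn_univ]

variable {G} in
lemma degIn_eq_zero_iff {S : Finset V} {v : V} : degIn G S v = 0 ↔ ∀ w ∈ S, ¬ G.Adj v w := by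
  rw [degIn, card_eq_zero, filter_eq_empty_iff]

variable {G} in
lemma degIn_eq_card_iff {S : Finset V} {v : V} : degIn G S v = #S ↔ ∀ w ∈ S, G.Adj v w := by
  rw [degIn, card_filter_eq_iff]

lemma degIn_le_card (S : Finset V) (v : V) : degIn G S v ≤ #S := card_filter_le ..

variable {G} in
lemma card_le_degIn {A S : Finset V} {v : V} (hA : A ⊆ S) (h : ∀ w ∈ A, G.Adj v w) :
    #A ≤ degIn G S v :=
  card_le_card fun w hw ↦ mem_filter.2 ⟨hA hw, h w hw⟩

lemma degIn_lt_card {S : Finset V} {v : V} (hv : v ∈ S) : degIn G S v < #S :=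
  card_lt_card ⟨filter_subset .., fun h ↦ G.irrefl (mem_filter.1 (h hv)).2⟩

lemma degree_induce_eq_degIn (S : Finset V) (v : (S : Set V))
    [Fintype ((G.induce (S : Set V)).neighborSet v)] :
    (G.induce (S : Set V)).degree v = degIn G S v := by
  refine card_nbij Subtype.val ?_ Subtype.val_injective.injOn ?_
  · intro w hw
    exact mem_filter.2 ⟨w.2, (mem_neighborFinset (G.induce (S : Set V)) v w).1 hw⟩
  · intro w hw
    obtain ⟨hwS, hadj⟩ := mem_filter.1 hw
    exact ⟨⟨w, hwS⟩, (mem_neighborFinset ..).2 hadj, rfl⟩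

lemma card_interedges_eq_sum_degIn (S T : Finset V) :
    #(G.interedges S T) = ∑ v ∈ S, degIn G T v := by
  rw [interedges_def, card_filter, sum_product]
  simp only [degIn, card_filter]

lemma card_interedges_comm (S T : Finset V) : #(G.interedges S T) = #(G.interedges T S) :=
  have := G.symm
  Rel.card_interedges_comm ..

lemma card_interedges_singleton_left (v : V) (S : Finset V) :
    #(G.interedges {v} S) = degIn G S v := by
  rw [card_interedges_eq_sum_degIn, sum_singleton]

lemma card_interedges_univ_self [Fintype V] :
    #(G.interedges univ univ) = 2 * #G.edgeFinset := by
  simp only [card_interedges_eq_sum_degIn, degIn_univ, sum_degrees_eq_twice_card_edges]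

variable {G} in
lemma two_mul_card_le_card_interedges_add_two {S : Finset V}
    (hS : (G.induce (S : Set V)).Connected) : 2 * #S ≤ #(G.interedges S S) + 2 := by
  have hcard := hS.card_vert_le_card_edgeSet_add_one
  have hsum := (G.induce (S : Set V)).sum_degrees_eq_twice_card_edges
  simp only [degree_induce_eq_degIn] at hsum
  rw [← sum_subtype S (fun _ ↦ mem_coe.symm) (degIn G S), ← card_interedges_eq_sum_degIn,
    edgeFinset_card, ← Nat.card_eq_fintype_card] at hsum
  rw [Nat.card_coe_set_eq (S : Set V), Set.ncard_coe_finset] at hcard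
  lia

section DecidableEq

variable [DecidableEq V]

lemma card_interedges_union_right {S T : Finset V} (h : Disjoint S T) (A : Finset V) :
    #(G.interedges A (S ∪ T)) = #(G.interedges A S) + #(G.interedges A T) := by
  simp only [card_interedges_eq_sum_degIn, degIn_union G h, sum_add_distrib]

lemma card_interedges_union_self {S T : Finset V} (h : Disjoint S T) :
    #(G.interedges (S ∪ T) (S ∪ T)) =
      #(G.interedges S S) + 2 * #(G.interedges S T) + #(G.interedges T T) := by
  rw [card_interedges_union_right G h, card_interedges_comm G _ S, card_interedges_comm G _ T,
    card_interedges_union_right G h, card_interedges_union_right G h, card_interedges_comm G T S]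
  ring

lemma card_interedges_insert_self {S : Finset V} {v : V} (hv : v ∉ S) :
    #(G.interedges (insert v S) (insert v S)) = #(G.interedges S S) + 2 * degIn G S v := by
  rw [insert_eq, card_interedges_union_self G (disjoint_singleton_left.2 hv),
    card_interedges_singleton_left, card_interedges_singleton_left,
    degIn_eq_zero_iff.2 (by simp)]
  ring

lemma sum_degree_eq_card_interedges_add [Fintype V] (S : Finset V) :
    ∑ v ∈ S, G.degree v = #(G.interedges S S) + #(G.interedges S Sᶜ) := by
  simp only [card_interedges_eq_sum_degIn, ← sum_add_distrib, degIn_add_degIn_compl]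

lemma two_mul_sum_degree_add_card_interedges_compl [Fintype V] (S : Finset V) :
    2 * ∑ v ∈ S, G.degree v + #(G.interedges Sᶜ Sᶜ) =
      2 * #G.edgeFinset + #(G.interedges S S) := by
  rw [← card_interedges_univ_self, ← union_compl S,
    card_interedges_union_self G disjoint_compl_right, sum_degree_eq_card_interedges_add]
  ring

end DecidableEq

variable {G} in
lemma card_interedges_self_add_le_of_degenerate {S : Finset V} {k : ℕ} (hk : k ≤ #S)
    (h : ∀ T ⊆ S, T.Nonempty → ∃ v ∈ T, degIn G T v ≤ k) :
    #(G.interedges S S) + k * (k + 1) ≤ 2 * k * #S := by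
  classical
  obtain ⟨m, hm⟩ := Nat.exists_eq_add_of_le' hk
  induction m generalizing S with
  | zero =>
    have hdeg : ∑ v ∈ S, (degIn G S v + 1) ≤ ∑ _v ∈ S, #S :=
      sum_le_sum fun v hv ↦ degIn_lt_card G hv
    rw [sum_add_distrib, ← card_interedges_eq_sum_degIn, sum_const, sum_const, hm] at hdeg
    rw [hm]
    simp only [smul_eq_mul] at hdeg
    linarith
  | succ m ih =>
    obtain ⟨v, hv, hdeg⟩ := h S subset_rfl (card_pos.1 (by lia))
    have hcard : #(S.erase v) = m + k := by rw [card_erase_of_mem hv]; lia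
    have hle := ih (by lia) (fun T hT ↦ h T (hT.trans (erase_subset v S))) hcard
    have hins := card_interedges_insert_self G (notMem_erase v S)
    rw [insert_erase hv] at hins
    have hdeg' := (degIn_mono G (erase_subset v S) v).trans hdeg
    rw [hcard] at hle
    rw [hm]
    linarith

end Counting

section Components

variable {V : Type*} {G : SimpleGraph V}

/-- `C` is (the vertex set of) a connected component of the subgraph of `G` induced on `S`. -/
structure IsInducedComponent (G : SimpleGraph V) (S C : Finset V) : Prop where
  subset : C ⊆ S
  connected : (G.induce (C : Set V)).Connected
  not_adj : ∀ v ∈ C, ∀ w ∈ S, w ∉ C → ¬ G.Adj v w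

lemma IsInducedComponent.nonempty {S C : Finset V} (h : IsInducedComponent G S C) : C.Nonempty :=
  coe_nonempty.1 (Set.nonempty_coe_sort.1 h.connected.nonempty)

lemma IsInducedComponent.degIn_eq [DecidableRel G.Adj] {S C : Finset V}
    (h : IsInducedComponent G S C) {v : V} (hv : v ∈ C) : degIn G C v = degIn G S v := by
  refine (degIn_mono G h.subset v).antisymm (card_le_card fun w hw ↦ ?_)
  obtain ⟨hwS, hvw⟩ := mem_filter.1 hw
  exact mem_filter.2 ⟨by_contra fun hwC ↦ h.not_adj v hv w hwS hwC hvw, hvw⟩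

lemma spanningCoe_induce_adj {S : Set V} {u v : V} :
    (G.induce S).spanningCoe.Adj u v ↔ u ∈ S ∧ v ∈ S ∧ G.Adj u v := by
  simp only [map_adj, comap_adj, Function.Embedding.subtype_apply, Subtype.exists]
  aesop

open Classical in
lemma isInducedComponent_filter_reachable {S : Finset V} {u : V} (hu : u ∈ S) :
    IsInducedComponent G S {v ∈ S | (G.induce (S : Set V)).spanningCoe.Reachable u v} := by
  set H : SimpleGraph V := (G.induce (S : Set V)).spanningCoe
  have hsupp : (({v ∈ S | H.Reachable u v} : Finset V) : Set V) =
      (H.connectedComponentMk u).supp := by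
    ext v
    simp only [coe_filter, Set.mem_ofPred_eq, ConnectedComponent.mem_supp_iff,
      ConnectedComponent.eq, H.reachable_comm (u := u), and_iff_right_iff_imp]
    rintro ⟨_ | ⟨hadj, -⟩⟩
    exacts [hu, (spanningCoe_induce_adj.1 hadj).1]
  refine ⟨filter_subset _ S, ?_, fun v hv w hw hwC hvw ↦ hwC ?_⟩
  · rw [hsupp]
    exact (H.connectedComponentMk u).connected_toSimpleGraph.mono
      fun a b (hab : H.Adj a b) ↦ (spanningCoe_induce_adj.1 hab).2.2
  · obtain ⟨hvS, huv⟩ := mem_filter.1 hv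
    exact mem_filter.2 ⟨hw, huv.trans (spanningCoe_induce_adj.2 ⟨hvS, hw, hvw⟩).reachable⟩

variable (G) in
lemma exists_finpartition_isInducedComponent [DecidableEq V] (S : Finset V) :
    ∃ P : Finpartition S, ∀ C ∈ P.parts, IsInducedComponent G S C := by
  classical
  refine ⟨Finpartition.ofSetSetoid (G.induce (S : Set V)).spanningCoe.reachableSetoid S,
    fun C hC ↦ ?_⟩
  obtain ⟨u, hu, rfl⟩ := mem_image.1 hC
  exact isInducedComponent_filter_reachable hu

lemma card_interedges_self_eq_sum_parts [DecidableEq V] [DecidableRel G.Adj] {S : Finset V}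
    (P : Finpartition S) (hP : ∀ C ∈ P.parts, IsInducedComponent G S C) :
    #(G.interedges S S) = ∑ C ∈ P.parts, #(G.interedges C C) := by
  refine (Rel.card_interedges_finpartition_left _ P S).trans (sum_congr rfl fun C hC ↦ ?_)
  change #(G.interedges C S) = _
  rw [card_interedges_eq_sum_degIn, card_interedges_eq_sum_degIn]
  exact sum_congr rfl fun v hv ↦ ((hP C hC).degIn_eq hv).symm

end Components

section HamiltonianPath

variable {V : Type*} {G : SimpleGraph V}

lemma ncard_neighborSet_eq_degree (v : V) [Fintype (G.neighborSet v)] :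
    (G.neighborSet v).ncard = G.degree v := by
  rw [Set.ncard_eq_toFinset_card', degree, neighborFinset]

variable [G.LocallyFinite]

lemma two_le_degree_of_isPath {u v : V} {p : G.Walk u v} (hp : p.IsPath) {i : ℕ} (hi : i ≠ 0)
    (hi' : i < p.length) : 2 ≤ G.degree (p.getVert i) := by
  rw [← hp.ncard_neighborSet_toSubgraph_internal_eq_two hi hi', ← ncard_neighborSet_eq_degree]
  exact Set.ncard_le_ncard (p.toSubgraph.neighborSet_subset _)

lemma three_le_degree_of_isPath {u v x : V} {p : G.Walk u v} (hp : p.IsPath) {i : ℕ}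
    (hi : i ≠ 0) (hi' : i < p.length) (hx : x ∉ p.support) (hadj : G.Adj (p.getVert i) x) :
    3 ≤ G.degree (p.getVert i) := by
  have hx' : x ∉ p.toSubgraph.neighborSet (p.getVert i) := fun h ↦
    hx ((p.mem_verts_toSubgraph).1 (p.toSubgraph.edge_vert h.symm))
  have hsub := p.toSubgraph.neighborSet_subset (p.getVert i)
  have hcard : (insert x (p.toSubgraph.neighborSet (p.getVert i))).ncard = 3 := by
    rw [Set.ncard_insert_of_notMem hx' ((Set.toFinite _).subset hsub),
      hp.ncard_neighborSet_toSubgraph_internal_eq_two hi hi']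
  rw [← hcard, ← ncard_neighborSet_eq_degree]
  exact Set.ncard_le_ncard (Set.insert_subset hadj hsub)

variable [DecidableEq V] [Finite V]

lemma exists_isHamiltonian_of_degree_le_two (hG : G.Connected) (hdeg : ∀ v, G.degree v ≤ 2) :
    ∃ (u v : V) (p : G.Walk u v), p.IsHamiltonian := by
  have := hG.nonempty
  obtain ⟨u, v, p, hp, hmax⟩ := Walk.exists_isPath_forall_isPath_length_le_length G
  refine ⟨u, v, p, hp.isHamiltonian_of_mem ?_⟩
  by_contra! ⟨w, hw⟩
  obtain ⟨⟨⟨a, b⟩, hab⟩, -, ha, hb⟩ :=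
    (hG u w).some.exists_boundary_dart {x | x ∈ p.support} p.start_mem_support hw
  obtain ⟨i, rfl, hi⟩ := Walk.mem_support_iff_exists_getVert.1 ha
  obtain rfl | hi0 := eq_or_ne i 0
  · rw [Walk.getVert_zero] at hab
    have := hmax _ _ (.cons hab.symm p) (hp.cons hb)
    simp at this
  obtain rfl | hi' := hi.eq_or_lt
  · rw [Walk.getVert_length] at hab
    have := hmax _ _ (p.concat hab) (hp.concat hb hab)
    simp at this
  · exact (three_le_degree_of_isPath hp hi0 hi' hb hab).not_gt (Nat.lt_succ_of_le (hdeg _))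

lemma exists_isHamiltonian_from (hG : G.Connected) (hdeg : ∀ v, G.degree v ≤ 2) {q : V}
    (hq : G.degree q ≤ 1) : ∃ (v : V) (p : G.Walk q v), p.IsHamiltonian := by
  obtain ⟨u, v, p, hp⟩ := exists_isHamiltonian_of_degree_le_two hG hdeg
  obtain ⟨i, rfl, hi⟩ := Walk.mem_support_iff_exists_getVert.1 (hp.mem_support q)
  obtain rfl | hi0 := eq_or_ne i 0
  · rw [p.getVert_zero]
    exact ⟨v, p, hp⟩
  obtain rfl | hi' := hi.eq_or_lt
  · rw [p.getVert_length]
    exact ⟨u, p.reverse, hp.isPath.reverse.isHamiltonian_of_mem fun w ↦ by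
      rw [p.support_reverse]; exact List.mem_reverse.2 (hp.mem_support w)⟩
  · exact absurd (two_le_degree_of_isPath hp.isPath hi0 hi') (by lia)

end HamiltonianPath

section Cycles

variable {V : Type*} {G : SimpleGraph V}

/-- `G` contains a cycle of length `i`. -/
def HasCycle (G : SimpleGraph V) (i : ℕ) : Prop :=
  ∃ (u : V) (p : G.Walk u u), p.IsCycle ∧ p.length = i

/-- `G` contains a path from `x` to `y` with exactly `t` internal vertices, all of them in `D`. -/
def HasPathThrough (G : SimpleGraph V) (D : Finset V) (t : ℕ) (x y : V) : Prop :=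
  ∃ p : G.Walk x y, p.IsPath ∧ p.length = t + 1 ∧ ∀ w ∈ p.support, w = x ∨ w = y ∨ w ∈ D

lemma HasPathThrough.symm {D : Finset V} {t : ℕ} {x y : V} (h : HasPathThrough G D t x y) :
    HasPathThrough G D t y x := by
  obtain ⟨p, hp, hlen, hsupp⟩ := h
  refine ⟨p.reverse, hp.reverse, p.length_reverse.trans hlen, fun w hw ↦ ?_⟩
  rw [p.support_reverse, List.mem_reverse] at hw
  exact or_left_comm.1 (hsupp w hw)

lemma start_notMem_support_tail {u v : V} {p : G.Walk u v} (hp : p.IsPath) :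
    u ∉ p.support.tail := by
  have := hp.support_nodup
  rw [← p.cons_tail_support, List.nodup_cons] at this
  exact this.1

lemma HasPathThrough.hasCycle {C D : Finset V} {s t : ℕ} {x y : V} (hCD : Disjoint C D)
    (hs : 1 ≤ s) (hC : HasPathThrough G C s x y) (hD : HasPathThrough G D t x y) :
    HasCycle G (s + t + 2) := by
  obtain ⟨p, hp, hplen, hpC⟩ := hC
  obtain ⟨q, hq, hqlen, hqD⟩ := hD.symm
  have hpx := start_notMem_support_tail hp
  have hqy := start_notMem_support_tail hq
  refine ⟨x, p.append q, hp.isCycle_append hq (fun w hwp hwq ↦ ?_) (by lia), ?_⟩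
  · have hwx : w ≠ x := fun h ↦ hpx (h ▸ hwp)
    have hwy : w ≠ y := fun h ↦ hqy (h ▸ hwq)
    have hwC := ((hpC w (List.mem_of_mem_tail hwp)).resolve_left hwx).resolve_left hwy
    have hwD := ((hqD w (List.mem_of_mem_tail hwq)).resolve_left hwy).resolve_left hwx
    exact Finset.disjoint_left.1 hCD hwC hwD
  · rw [Walk.length_append]
    lia

lemma hasCycle_of_cone {u v x : V} {p : G.Walk u v} (hp : p.IsPath) (hlen : 1 ≤ p.length)
    (hx : x ∉ p.support) (hxu : G.Adj x u) (hxv : G.Adj x v) : HasCycle G (p.length + 2) := by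
  have hne : u ≠ v := by
    rintro rfl
    exact absurd (Walk.length_eq_zero_iff.2 (Walk.isPath_iff_nil.1 hp)) (by lia)
  refine ⟨u, p.append (.cons hxv.symm (.cons hxu .nil)), hp.isCycle_append ?_ ?_ ?_, ?_⟩
  · simp [hxv.ne', hne.symm, hxu.ne]
  · simpa using ⟨fun h ↦ hx (List.mem_of_mem_tail h), start_notMem_support_tail hp⟩
  · simp
  · simp

lemma exists_isPath_of_isHamiltonian_induce [DecidableEq V] {D : Finset V} {q b : (D : Set V)}
    {p : (G.induce (D : Set V)).Walk q b} (hp : p.IsHamiltonian) {t : ℕ} (ht : t < #D) :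
    ∃ (v : V) (r : G.Walk q v), r.IsPath ∧ r.length = t ∧ ∀ w ∈ r.support, w ∈ D := by
  have hcard := hp.length_eq
  rw [Fintype.card_eq_nat_card, Nat.card_coe_set_eq, Set.ncard_coe_finset] at hcard
  let f : G.induce (D : Set V) →g G := (Embedding.induce _).toHom
  suffices ∃ (v : V) (r : G.Walk (f q) v), r.IsPath ∧ r.length = t ∧ ∀ w ∈ r.support, w ∈ D from
    this
  refine ⟨_, (p.take t).map f, (hp.isPath.take t).map Subtype.val_injective, ?_, fun w hw ↦ ?_⟩
  · rw [Walk.length_map, Walk.take_length]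
    lia
  · rw [Walk.support_map] at hw
    obtain ⟨w', -, rfl⟩ := List.mem_map.1 hw
    exact w'.2

lemma hasCycle_of_forall_adj [DecidableEq V] {D : Finset V} {a b : (D : Set V)}
    {p : (G.induce (D : Set V)).Walk a b} (hp : p.IsHamiltonian) {x : V}
    (hx : ∀ w ∈ D, G.Adj x w) {i : ℕ} (hi : 3 ≤ i) (hi' : i ≤ #D + 1) : HasCycle G i := by
  obtain ⟨v, r, hr, hlen, hrD⟩ := exists_isPath_of_isHamiltonian_induce hp (t := i - 2) (by lia)
  have := hasCycle_of_cone hr (by lia) (fun h ↦ G.irrefl (hx x (hrD x h))) (hx a a.2)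
    (hx v (hrD v r.end_mem_support))
  rwa [hlen, Nat.sub_add_cancel (by lia)] at this

lemma hasPathThrough_of_forall_adj [DecidableEq V] {D : Finset V} {q b : (D : Set V)}
    {p : (G.induce (D : Set V)).Walk q b} (hp : p.IsHamiltonian) {x y : V} (hxy : x ≠ y)
    (hy : y ∉ D) (hyq : G.Adj y q) (hx : ∀ w ∈ D, G.Adj x w) {t : ℕ} (ht : t < #D) :
    HasPathThrough G D (t + 1) x y := by
  obtain ⟨v, r, hr, hlen, hrD⟩ := exists_isPath_of_isHamiltonian_induce hp ht
  have hxr : x ∉ r.support := fun h ↦ G.irrefl (hx x (hrD x h))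
  have hyr : y ∉ r.support := fun h ↦ hy (hrD y h)
  have hvx := (hx v (hrD v r.end_mem_support)).symm
  refine HasPathThrough.symm ⟨.cons hyq (r.concat hvx), (hr.concat hxr hvx).cons ?_, ?_, ?_⟩
  · simp [hyr, hxy.symm]
  · simp [hlen]
  · simp only [Walk.support_cons, Walk.support_concat, List.mem_cons, List.mem_append]
    grind

end Cycles

section Critical

variable {V : Type*} [Fintype V] (G : SimpleGraph V) [DecidableRel G.Adj]

/-- The vertices of degree `3`. -/
def cubicVerts : Finset V := {v | G.degree v = 3}

/-- `G` has `2 * n - 2` edges, where `n` is its number of vertices, and no proper induced subgraph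
of `G` has minimum degree at least `3`. This is the minimality needed for counting edges. -/
structure IsVertexCritical : Prop where
  card_edgeFinset : #G.edgeFinset + 2 = 2 * Fintype.card V
  exists_degIn_le_two : ∀ S : Finset V, S.Nonempty → S ≠ univ → ∃ v ∈ S, degIn G S v ≤ 2

/-- Vertex-criticality together with minimality under deleting edges: in a graph of minimum degree
`3` the latter says that every edge has an end of degree `3`. -/
structure IsCritical : Prop extends IsVertexCritical G where
  degree_eq_three_or : ∀ u v, G.Adj u v → G.degree u = 3 ∨ G.degree v = 3

variable {G}

lemma mem_cubicVerts {v : V} : v ∈ cubicVerts G ↔ G.degree v = 3 := mem_filter_univ ..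

lemma sum_degree_of_subset_cubicVerts {C : Finset V} (hC : C ⊆ cubicVerts G) :
    ∑ v ∈ C, G.degree v = 3 * #C := by
  rw [sum_congr rfl fun v hv ↦ mem_cubicVerts.1 (hC hv), sum_const, smul_eq_mul, mul_comm]

lemma exists_isHamiltonian_induce_of_adj [DecidableEq V] {x y : V} (hxy : x ≠ y)
    (hI : (cubicVerts G)ᶜ = {x, y}) {D : Finset V} (hD : IsInducedComponent G (cubicVerts G) D)
    (hx : ∀ w ∈ D, G.Adj x w) {q : V} (hq : q ∈ D) (hyq : G.Adj y q) :
    ∃ (b : (D : Set V)) (p : (G.induce (D : Set V)).Walk ⟨q, hq⟩ b), p.IsHamiltonian := by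
  have hdeg (v : (D : Set V)) : (G.induce (D : Set V)).degree v + degIn G {x, y} v = 3 := by
    rw [degree_induce_eq_degIn, hD.degIn_eq v.2, ← hI, degIn_add_degIn_compl,
      mem_cubicVerts.1 (hD.subset v.2)]
  refine exists_isHamiltonian_from hD.connected (fun v ↦ ?_) ?_
  · have := card_le_degIn (G := G) (A := {x}) (S := {x, y}) (v := v) (by simp)
      (by simp [(hx v v.2).symm])
    rw [card_singleton] at this
    have := hdeg v
    lia
  · have := card_le_degIn (G := G) (A := {x, y}) (v := q) subset_rfl
      (by simp [(hx q hq).symm, hyq.symm])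
    rw [card_pair hxy] at this
    have := hdeg ⟨q, hq⟩
    lia

namespace IsVertexCritical

variable (hG : IsVertexCritical G)

include hG

lemma card_interedges_add_le_sum_degree [DecidableEq V] {A : Finset V} (hA : A.Nonempty)
    (hA' : 2 ≤ #Aᶜ) :
    #(G.interedges A A) + 4 * #A + 2 ≤ 2 * ∑ v ∈ A, G.degree v := by
  have hdeg : #(G.interedges Aᶜ Aᶜ) + 2 * (2 + 1) ≤ 2 * 2 * #Aᶜ :=
    card_interedges_self_add_le_of_degenerate hA' fun S hS hne ↦
      hG.exists_degIn_le_two S hne fun h ↦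
        hA.ne_empty (compl_eq_univ_iff A |>.1 (univ_subset_iff.1 (h ▸ hS)))
  have := two_mul_sum_degree_add_card_interedges_compl G A
  have := hG.card_edgeFinset
  have := card_add_card_compl A
  lia

lemma three_le_degree (hV : 3 ≤ Fintype.card V) (v : V) : 3 ≤ G.degree v := by
  classical
  have := hG.card_interedges_add_le_sum_degree (singleton_nonempty v)
    (by rw [card_compl, card_singleton]; lia)
  rw [card_singleton, sum_singleton] at this
  lia

lemma four_le_degree (hV : 3 ≤ Fintype.card V) {v : V} (hv : v ∉ cubicVerts G) :
    4 ≤ G.degree v :=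
  (hG.three_le_degree hV v).lt_of_ne' fun h ↦ hv (mem_cubicVerts.2 h)

lemma card_interedges_add_two [DecidableEq V] {C : Finset V}
    (hC : IsInducedComponent G (cubicVerts G) C) (hC' : 2 ≤ #Cᶜ) :
    #(G.interedges C C) + 2 = 2 * #C := by
  have := hG.card_interedges_add_le_sum_degree hC.nonempty hC'
  rw [sum_degree_of_subset_cubicVerts hC.subset] at this
  have := two_mul_card_le_card_interedges_add_two hC.connected
  lia

lemma exists_notMem_cubicVerts [DecidableEq V] {C : Finset V}
    (hC : IsInducedComponent G (cubicVerts G) C) (hC' : Cᶜ.Nonempty) :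
    ∃ w ∉ cubicVerts G, degIn G Cᶜ w ≤ 2 := by
  obtain ⟨w, hwC, hw⟩ := hG.exists_degIn_le_two Cᶜ hC' fun h ↦
    hC.nonempty.ne_empty ((compl_eq_univ_iff C).1 h)
  refine ⟨w, fun hw3 ↦ ?_, hw⟩
  have hzero : degIn G C w = 0 := degIn_eq_zero_iff.2 fun v hv hadj ↦
    hC.not_adj v hv w hw3 (mem_compl.1 hwC) hadj.symm
  have := degIn_add_degIn_compl G C w
  rw [mem_cubicVerts.1 hw3] at this
  lia

lemma card_compl_cubicVerts_le_two [DecidableEq V] (hV : 3 ≤ Fintype.card V)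
    {C D : Finset V} (hC : IsInducedComponent G (cubicVerts G) C)
    (hD : IsInducedComponent G (cubicVerts G) D) (hCD : Disjoint C D) {w : V}
    (hw : w ∉ cubicVerts G) (hwC : degIn G Cᶜ w ≤ 2) (hwD : degIn G Dᶜ w ≤ 2) :
    #(cubicVerts G)ᶜ ≤ 2 := by
  have hsub : C ∪ D ⊆ cubicVerts G := union_subset hC.subset hD.subset
  have hwCD : w ∉ C ∪ D := fun h ↦ hw (hsub h)
  by_contra! hlt
  have hcompl : (cubicVerts G)ᶜ.erase w ⊆ (insert w (C ∪ D))ᶜ := by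
    rw [compl_insert]
    exact erase_subset_erase w (compl_subset_compl.2 hsub)
  have hexp := hG.card_interedges_add_le_sum_degree (insert_nonempty w (C ∪ D))
    (by have := card_le_card hcompl; rw [card_erase_of_mem (mem_compl.2 hw)] at this; lia)
  rw [card_interedges_insert_self G hwCD, card_interedges_union_self G hCD, sum_insert hwCD,
    sum_degree_of_subset_cubicVerts hsub, card_insert_of_notMem hwCD, card_union_of_disjoint hCD,
    degIn_union G hCD] at hexp
  have := two_mul_card_le_card_interedges_add_two hC.connected
  have := two_mul_card_le_card_interedges_add_two hD.connected
  have := degIn_add_degIn_compl G C w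
  have := degIn_add_degIn_compl G D w
  have := hG.four_le_degree hV hw
  lia

lemma degree_add_one_eq_card {w : V} (hw : ∀ v ≠ w, G.degree v = 3) :
    G.degree w + 1 = Fintype.card V := by
  classical
  have hsum := G.sum_degrees_eq_twice_card_edges
  rw [← add_sum_erase univ _ (mem_univ w), sum_degree_of_subset_cubicVerts fun v hv ↦
    mem_cubicVerts.2 (hw v (ne_of_mem_erase hv)), card_erase_of_mem (mem_univ w), card_univ]
    at hsum
  have := hG.card_edgeFinset
  lia

lemma connected_induce_compl_singleton [DecidableEq V] {w : V} (hw : ∀ v ≠ w, G.degree v = 3)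
    (hV : 2 ≤ Fintype.card V) :
    (G.induce (({w}ᶜ : Finset V) : Set V)).Connected := by
  obtain ⟨u, hu⟩ : ({w}ᶜ : Finset V).Nonempty :=
    card_pos.1 (by rw [card_compl, card_singleton]; lia)
  obtain ⟨X, hX⟩ : ∃ X, IsInducedComponent G {w}ᶜ X := ⟨_, isInducedComponent_filter_reachable hu⟩
  have hw' {v : V} (hv : v ∈ X) : v ≠ w := notMem_singleton.1 (mem_compl.1 (hX.subset hv))
  have hdegIn : ∀ v ∈ X, 2 ≤ degIn G X v := fun v hv ↦ by
    have := degIn_add_degIn_compl G {w} v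
    have := degIn_le_card G {w} v
    rw [hX.degIn_eq hv]
    grind
  have hinter := sum_le_sum hdegIn
  rw [← card_interedges_eq_sum_degIn, sum_const, smul_eq_mul] at hinter
  suffices X = {w}ᶜ from this ▸ hX.connected
  by_contra hne
  have hlt := card_lt_card (hX.subset.ssubset_of_ne hne)
  rw [card_compl, card_singleton] at hlt
  have := hG.card_interedges_add_le_sum_degree hX.nonempty (by rw [card_compl]; lia)
  rw [sum_degree_of_subset_cubicVerts fun v hv ↦ mem_cubicVerts.2 (hw v (hw' hv))] at this
  lia

lemma isPancyclic_of_degree_eq_three {w : V} (hw : ∀ v ≠ w, G.degree v = 3) :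
    IsPancyclic G := by
  classical
  intro i hi hin
  have hadj : ∀ v ∈ ({w}ᶜ : Finset V), G.Adj w v := degIn_eq_card_iff.1 <| by
    have := hG.degree_add_one_eq_card hw
    have := degIn_add_degIn_compl G {w} w
    have hlt := degIn_lt_card G (mem_singleton_self w)
    rw [card_singleton] at hlt
    rw [card_compl, card_singleton]
    lia
  have hconn := hG.connected_induce_compl_singleton hw (by lia)
  obtain ⟨a, b, p, hp⟩ := exists_isHamiltonian_of_degree_le_two hconn fun ⟨v, hv⟩ ↦ by
    have hvw : 1 ≤ degIn G {w} v := card_le_degIn (A := {w}) subset_rfl fun u hu ↦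
      (mem_singleton.1 hu) ▸ (hadj v hv).symm
    have := degIn_add_degIn_compl G {w} v
    rw [hw v (notMem_singleton.1 (mem_compl.1 hv))] at this
    rw [degree_induce_eq_degIn]
    lia
  exact hasCycle_of_forall_adj hp hadj hi (by rw [card_compl, card_singleton]; lia)

lemma degIn_add_degIn_eq_card_add_two [DecidableEq V] {x y : V} (hxy : x ≠ y)
    (hI : (cubicVerts G)ᶜ = {x, y}) {D : Finset V} (hD : IsInducedComponent G (cubicVerts G) D) :
    degIn G D x + degIn G D y = #D + 2 := by
  have hcompl := card_le_card (compl_subset_compl.2 hD.subset)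
  rw [hI, card_pair hxy] at hcompl
  have hinner := hG.card_interedges_add_two hD hcompl
  have hsum : ∑ v ∈ D, (degIn G D v + degIn G {x, y} v) = ∑ v ∈ D, G.degree v :=
    sum_congr rfl fun v hv ↦ by rw [hD.degIn_eq hv, ← hI, degIn_add_degIn_compl]
  rw [sum_add_distrib, ← card_interedges_eq_sum_degIn, ← card_interedges_eq_sum_degIn,
    card_interedges_comm G D {x, y}, card_interedges_eq_sum_degIn G {x, y}, sum_pair hxy,
    sum_degree_of_subset_cubicVerts hD.subset] at hsum
  lia

lemma hasPathThrough_and_hasCycle_three_of_degIn_le_two {x y : V} (hxy : x ≠ y)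
    (hI : ∀ v, v ∉ cubicVerts G ↔ v = x ∨ v = y) {D : Finset V}
    (hD : IsInducedComponent G (cubicVerts G) D) (hy : degIn G D y ≤ 2) :
    (∀ t < #D, HasPathThrough G D (t + 1) x y) ∧ HasCycle G 3 := by
  classical
  have hI' : (cubicVerts G)ᶜ = {x, y} := by
    ext v
    rw [mem_compl, hI, mem_insert, mem_singleton]
  have hsum := hG.degIn_add_degIn_eq_card_add_two hxy hI' hD
  have hxle := degIn_le_card G D x
  have hyD : y ∉ D := fun h ↦ (hI y).2 (.inr rfl) (hD.subset h)
  have hx : ∀ w ∈ D, G.Adj x w := degIn_eq_card_iff.1 (by lia)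
  have hyle := degIn_le_card G D y
  obtain ⟨q, hq⟩ : {w ∈ D | G.Adj y w}.Nonempty := card_pos.1 (show 0 < degIn G D y by lia)
  obtain ⟨hqD, hyq⟩ := mem_filter.1 hq
  obtain ⟨b, p, hp⟩ := exists_isHamiltonian_induce_of_adj hxy hI' hD hx hqD hyq
  exact ⟨fun t ht ↦ hasPathThrough_of_forall_adj hp hxy hyD hyq hx ht,
    hasCycle_of_forall_adj hp hx le_rfl (by lia)⟩

lemma hasPathThrough_and_hasCycle_three {x y : V} (hxy : x ≠ y)
    (hI : ∀ v, v ∉ cubicVerts G ↔ v = x ∨ v = y) {C D : Finset V}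
    (hC : IsInducedComponent G (cubicVerts G) C) (hD : IsInducedComponent G (cubicVerts G) D)
    (hCD : Disjoint C D) :
    (∀ t < #D, HasPathThrough G D (t + 1) x y) ∧ HasCycle G 3 := by
  classical
  obtain ⟨w, hw, hwC⟩ := hG.exists_notMem_cubicVerts hC
    ⟨x, mem_compl.2 fun h ↦ (hI x).2 (.inl rfl) (hC.subset h)⟩
  have hwD := (degIn_mono G (subset_compl_iff_disjoint_left.2 hCD) w).trans hwC
  obtain rfl | rfl := (hI w).1 hw
  · obtain ⟨hpath, hcycle⟩ := hG.hasPathThrough_and_hasCycle_three_of_degIn_le_two hxy.symm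
      (fun v ↦ (hI v).trans or_comm) hD hwD
    exact ⟨fun t ht ↦ (hpath t ht).symm, hcycle⟩
  · exact hG.hasPathThrough_and_hasCycle_three_of_degIn_le_two hxy hI hD hwD

lemma isPancyclic_of_union_eq_cubicVerts [DecidableEq V] (hI : #(cubicVerts G)ᶜ = 2)
    {C D : Finset V} (hC : IsInducedComponent G (cubicVerts G) C)
    (hD : IsInducedComponent G (cubicVerts G) D) (hCD : Disjoint C D)
    (hunion : C ∪ D = cubicVerts G) : IsPancyclic G := by
  intro i hi hin
  obtain ⟨x, y, hxy, hxyI⟩ := card_eq_two.1 hI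
  have hmem (v : V) : v ∉ cubicVerts G ↔ v = x ∨ v = y := by
    rw [← mem_compl, hxyI, mem_insert, mem_singleton]
  obtain ⟨hpathC, hcycle⟩ := hG.hasPathThrough_and_hasCycle_three hxy hmem hD hC hCD.symm
  obtain ⟨hpathD, -⟩ := hG.hasPathThrough_and_hasCycle_three hxy hmem hC hD hCD
  obtain rfl | hi4 := hi.eq_or_lt
  · exact hcycle
  have hcard := card_add_card_compl (cubicVerts G)
  rw [hI, ← hunion, card_union_of_disjoint hCD] at hcard
  have := card_pos.2 hC.nonempty
  have := card_pos.2 hD.nonempty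
  obtain ⟨s, t, hs, ht, rfl⟩ : ∃ s t, s < #C ∧ t < #D ∧ s + 1 + (t + 1) + 2 = i :=
    ⟨min (i - 4) (#C - 1), i - 4 - min (i - 4) (#C - 1), by lia, by lia, by lia⟩
  exact (hpathC s hs).hasCycle hCD (by lia) (hpathD t ht)

end IsVertexCritical

namespace IsCritical

variable (hG : IsCritical G)

include hG

lemma card_parts_add_two [DecidableEq V] (hI : 2 ≤ #(cubicVerts G)ᶜ)
    {P : Finpartition (cubicVerts G)}
    (hP : ∀ C ∈ P.parts, IsInducedComponent G (cubicVerts G) C) :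
    #P.parts + 2 = 2 * #(cubicVerts G)ᶜ := by
  have hindep : #(G.interedges (cubicVerts G)ᶜ (cubicVerts G)ᶜ) = 0 := by
    rw [card_interedges_eq_sum_degIn]
    refine sum_eq_zero fun v hv ↦ degIn_eq_zero_iff.2 fun w hw hvw ↦ ?_
    rw [mem_compl, mem_cubicVerts] at hv hw
    exact (hG.degree_eq_three_or v w hvw).elim hv hw
  have hinner : #(G.interedges (cubicVerts G) (cubicVerts G)) + 2 * #P.parts =
      2 * #(cubicVerts G) := by
    rw [card_interedges_self_eq_sum_parts P hP, ← P.sum_card_parts, mul_sum, mul_comm 2,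
      ← smul_eq_mul, ← sum_const, ← sum_add_distrib]
    exact sum_congr rfl fun C hC ↦ hG.card_interedges_add_two (hP C hC)
      (hI.trans (card_le_card (compl_subset_compl.2 (hP C hC).subset)))
  have hdeg := two_mul_sum_degree_add_card_interedges_compl G (cubicVerts G)
  rw [sum_degree_of_subset_cubicVerts subset_rfl] at hdeg
  have := hG.card_edgeFinset
  have := card_add_card_compl (cubicVerts G)
  lia

lemma card_compl_cubicVerts_le_two [DecidableEq V] (hV : 3 ≤ Fintype.card V) :
    #(cubicVerts G)ᶜ ≤ 2 := by
  by_contra! hlt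
  obtain ⟨P, hP⟩ := exists_finpartition_isInducedComponent G (cubicVerts G)
  have hparts := hG.card_parts_add_two hlt.le hP
  have : Nonempty V := Fintype.card_pos_iff.1 (by lia)
  choose! w hw hwC using fun C hC ↦ hG.exists_notMem_cubicVerts (hP C hC)
    ((card_pos.1 (by lia)).mono (compl_subset_compl.2 (hP C hC).subset))
  -- With `k` vertices outside `cubicVerts G` there are `2 * k - 2 > k` components.
  obtain ⟨C, hC, D, hD, hne, hCD⟩ := exists_ne_map_eq_of_card_lt_of_maps_to
    (f := w) (t := (cubicVerts G)ᶜ) (by lia) fun C hC ↦ mem_coe.2 (mem_compl.2 (hw C hC))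
  exact hlt.not_ge (hG.toIsVertexCritical.card_compl_cubicVerts_le_two hV (hP C hC) (hP D hD)
    (P.disjoint hC hD hne) (hw C hC) (hwC C hC) (hCD ▸ hwC D hD))

lemma isPancyclic (hV : 3 ≤ Fintype.card V) : IsPancyclic G := by
  classical
  obtain hI | hI := (hG.card_compl_cubicVerts_le_two hV).lt_or_eq
  · have : Nonempty V := Fintype.card_pos_iff.1 (by lia)
    obtain ⟨w, hw⟩ := card_le_one_iff_subset_singleton.1 (Nat.le_of_lt_succ hI)
    exact hG.isPancyclic_of_degree_eq_three (w := w) fun v hv ↦ by_contra fun h ↦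
      hv (mem_singleton.1 (hw (mem_compl.2 (mt mem_cubicVerts.1 h))))
  · obtain ⟨P, hP⟩ := exists_finpartition_isInducedComponent G (cubicVerts G)
    have hparts := hG.card_parts_add_two hI.ge hP
    obtain ⟨C, D, hCD, hPCD⟩ := card_eq_two.1 (show #P.parts = 2 by lia)
    have hC : C ∈ P.parts := by simp [hPCD]
    have hD : D ∈ P.parts := by simp [hPCD]
    exact hG.isPancyclic_of_union_eq_cubicVerts hI (hP C hC) (hP D hD) (P.disjoint hC hD hCD)
      (by simpa [hPCD] using P.biUnion_parts)

end IsCritical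

end Critical

section MinDegree

variable {V : Type*} {G : SimpleGraph V}

lemma neighborSet_deleteEdges_of_ne {H : G.Subgraph} {u v w : V} (hu : w ≠ u) (hv : w ≠ v) :
    (H.deleteEdges {s(u, v)}).neighborSet w = H.neighborSet w := by
  ext z
  simp [hu, hv]

lemma ncard_neighborSet_le_deleteEdges [Finite V] (H : G.Subgraph) (u v w : V) :
    (H.neighborSet w).ncard ≤ ((H.deleteEdges {s(u, v)}).neighborSet w).ncard + 1 := by
  classical
  have hsub : H.neighborSet w ⊆
      insert (if w = u then v else u) ((H.deleteEdges {s(u, v)}).neighborSet w) := fun z hz ↦ by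
    simp only [Set.mem_insert_iff, Subgraph.mem_neighborSet, Subgraph.deleteEdges_adj,
      Set.mem_singleton_iff, Sym2.eq_iff] at hz ⊢
    grind
  exact (Set.ncard_le_ncard hsub).trans (Set.ncard_insert_le ..)

variable [Fintype V]

lemma subgraphHasMinDegree_of_ncard {H : G.Subgraph} {d : ℕ}
    (hge : ∀ v ∈ H.verts, d ≤ (H.neighborSet v).ncard)
    (hle : ∃ v ∈ H.verts, (H.neighborSet v).ncard ≤ d) : SubgraphHasMinDegree H d := by
  classical
  have hdeg (v : H.verts) {_ : Fintype (H.coe.neighborSet v)} :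
      H.coe.degree v = (H.neighborSet v).ncard := by
    rw [← ncard_neighborSet_eq_degree, ← Nat.card_coe_set_eq, ← Nat.card_coe_set_eq,
      Nat.card_congr (H.coeNeighborSetEquiv v)]
  obtain ⟨v, hv, hvd⟩ := hle
  have : Nonempty H.verts := ⟨v, hv⟩
  have hmin : H.coe.minDegree = d :=
    ((H.coe.minDegree_le_degree ⟨v, hv⟩).trans ((hdeg ⟨v, hv⟩).trans_le hvd)).antisymm
      (H.coe.le_minDegree_of_forall_le_degree d fun u ↦ (hge u u.2).trans_eq (hdeg u).symm)
  unfold SubgraphHasMinDegree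
  convert hmin

lemma exists_subgraphHasMinDegree_le {H : G.Subgraph} {d : ℕ} (hne : H.verts.Nonempty)
    (hdeg : ∀ v ∈ H.verts, d ≤ (H.neighborSet v).ncard) :
    ∃ K ≤ H, SubgraphHasMinDegree K d := by
  induction H using WellFoundedLT.induction with
  | ind H ih =>
    by_cases! hle : ∃ v ∈ H.verts, (H.neighborSet v).ncard ≤ d
    · exact ⟨H, le_rfl, subgraphHasMinDegree_of_ncard hdeg hle⟩
    obtain ⟨u, hu⟩ := hne
    obtain ⟨v, huv⟩ := (Set.ncard_pos (Set.toFinite _)).1 (Nat.zero_lt_of_lt (hle u hu))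
    have hlt : H.deleteEdges {s(u, v)} < H := by
      refine (H.deleteEdges_le _).lt_of_ne fun h ↦ ?_
      have huv' : (H.deleteEdges {s(u, v)}).Adj u v := h.symm ▸ huv
      exact (Subgraph.deleteEdges_adj ..|>.1 huv').2 rfl
    obtain ⟨K, hKH, hK⟩ := ih _ hlt ⟨u, hu⟩ fun w hw ↦ Nat.le_of_lt_succ <|
      (hle w hw).trans_le (ncard_neighborSet_le_deleteEdges H u v w)
    exact ⟨K, hKH.trans hlt.le, hK⟩

lemma exists_ncard_neighborSet_lt {d : ℕ}
    (hG : ∀ H : G.Subgraph, H ≠ ⊤ → ¬ SubgraphHasMinDegree H d) {H : G.Subgraph} (hH : H ≠ ⊤)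
    (hne : H.verts.Nonempty) : ∃ v ∈ H.verts, (H.neighborSet v).ncard < d := by
  by_contra! hdeg
  obtain ⟨K, hKH, hK⟩ := exists_subgraphHasMinDegree_le hne hdeg
  exact hG K (ne_top_of_le_ne_top hH hKH) hK

lemma exists_degIn_lt_of_forall_not_subgraphHasMinDegree [DecidableRel G.Adj] {d : ℕ}
    (hG : ∀ H : G.Subgraph, H ≠ ⊤ → ¬ SubgraphHasMinDegree H d) {S : Finset V}
    (hS : S.Nonempty) (hS' : S ≠ univ) : ∃ v ∈ S, degIn G S v < d := by
  have hne : (⊤ : G.Subgraph).induce S ≠ ⊤ := fun h ↦ hS' <| coe_eq_univ.1 <| by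
    simpa using congrArg Subgraph.verts h
  obtain ⟨v, hv, hlt⟩ := exists_ncard_neighborSet_lt hG hne hS
  have hnbhd : ((⊤ : G.Subgraph).induce S).neighborSet v = ↑({w ∈ S | G.Adj v w} : Finset V) := by
    ext w
    simp [mem_coe.1 hv]
  rw [hnbhd, Set.ncard_coe_finset] at hlt
  exact ⟨v, hv, hlt⟩

lemma degree_eq_or_of_forall_not_subgraphHasMinDegree [DecidableRel G.Adj] {d : ℕ}
    (hG : ∀ H : G.Subgraph, H ≠ ⊤ → ¬ SubgraphHasMinDegree H d) (hd : ∀ v, d ≤ G.degree v)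
    {u v : V} (huv : G.Adj u v) : G.degree u = d ∨ G.degree v = d := by
  by_contra! ⟨hu, hv⟩
  have hadj : (⊤ : G.Subgraph).Adj u v := huv
  obtain ⟨w, -, hw⟩ := exists_ncard_neighborSet_lt hG (H := (⊤ : G.Subgraph).deleteEdges {s(u, v)})
    (fun h ↦ (Subgraph.deleteEdges_adj .. |>.1 (h.symm ▸ hadj)).2 rfl) ⟨u, trivial⟩
  have hdeg : ((⊤ : G.Subgraph).neighborSet w).ncard = G.degree w := by
    rw [Subgraph.neighborSet_top, ncard_neighborSet_eq_degree]
  have hwd : G.degree w = d := by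
    have := ncard_neighborSet_le_deleteEdges (⊤ : G.Subgraph) u v w
    have := hd w
    lia
  rw [neighborSet_deleteEdges_of_ne (by rintro rfl; exact hu hwd) (by rintro rfl; exact hv hwd),
    hdeg] at hw
  exact hw.ne hwd

end MinDegree

theorem mainTheorem4 {V : Type*} [Fintype V] [DecidableEq V]
    (G : SimpleGraph V) [DecidableRel G.Adj] (n : ℕ)
    (hn : Fintype.card V = n)
    (he : (G.edgeFinset.card : ℤ) = 2 * (n : ℤ) - 2)
    (hG : ∀ H : G.Subgraph, H ≠ ⊤ → ¬ SubgraphHasMinDegree H 3) :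
    IsPancyclic G := by
  intro i hi hin
  have hvert : IsVertexCritical G :=
    ⟨by lia, fun S hS hne ↦ (exists_degIn_lt_of_forall_not_subgraphHasMinDegree hG hS hne).imp
      fun v ↦ And.imp_right Nat.le_of_lt_succ⟩
  have hcrit : IsCritical G := ⟨hvert, fun u v ↦
    degree_eq_or_of_forall_not_subgraphHasMinDegree hG (hvert.three_le_degree (hi.trans hin))⟩
  exact hcrit.isPancyclic (hi.trans hin) i hi hin
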